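/- Let $\alpha\in(0,1)$, let $N\in\mathbb N$ with $N>2\alpha$, and put $2^*_\alpha=\frac{2N}{N-2\alpha}$. Let $V,K:\mathbb R^N\to\mathbb R$ be continuous functions such that - $(VK_1)$ $V(x)>0$ and $K(x)>0$ for all $x\in\mathbb R^N$, and $K\in L^\infty(\mathbb R^N)$; - $(VK_2)$ for every sequence $(A_n)$ of Borel subsets of $\mathbb R^N$ with $|A_n|\le R$ for all $n$ and some $R>0$, one has $\lim_{r\to+\infty}\int_{A_n\setminus B_r(0)}K(x)\,dx=0$ uniformly in $n$; and at least one of the following holds: - $(VK_3)$ $K/V\in L^\infty(\mathbb R^N)$; - $(VK_4)$ there is $m\in(2,2^*_\alpha)$ such that $K(x)\,V(x)^{-\frac{2^*_\alpha-m}{2^*_\alpha-2}}\to0$ as $|x|\to+\infty$. (These conditions are abbreviated $(V,K)\in\mathcal K$.) For measurable $u:\mathbb R^N\to\mathbb R$ let $[u]^2=\iint_{\mathbb R^{2N}}\frac{|u(x)-u(y)|^2}{|x-y|^{N+2\alpha}}\,dx\,dy$. Let $\mathcal D^{\alpha,2}(\mathbb R^N)$ be the closure of $C_c^\infty(\mathbb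 R^N)$ with respect to $[\cdot]$ in $L^{2^*_\alpha}(\mathbb R^N)$, that is, the set of $u\in L^{2^*_\alpha}(\mathbb R^N)$ for which there are $\varphi_n\in C_c^\infty(\mathbb R^N)$ with $[u-\varphi_n]\to0$. Let $$\mathbb X=\Big\{u\in\mathcal D^{\alpha,2}(\mathbb R^N):\int_{\mathbb R^N}V|u|^2\,dx<\infty\Big\},\qquad \|u\|^2=[u]^2+\int_{\mathbb R^N}V|u|^2\,dx,$$ and, for $q\ge1$, let $L^q_K(\mathbb R^N)$ be the space of measurable $u:\mathbb R^N\to\mathbb R$ with $\int_{\mathbb R^N}K|u|^q\,dx<\infty$, normed by $\|u\|_{L^q_K}=\big(\int_{\mathbb R^N}K|u|^q\,dx\big)^{1/q}$ (functions equal almost everywhere being identified). Then: 1. if $(VK_3)$ holds, $\mathbb X$ is compactly embedded into $L^q_K(\mathbb R^N)$ for every $q\in(2,2^*_\alpha)$; 2. if $(VK_4)$ holds with exponent $m$, $\mathbb X$ is compactly embedded into $L^m_K(\mathbb R^N)$. Here "compactly embedded" means that $\mathbb X$ is contained in the target space, that the inclusion is continuous, and that every sequence bounded in $\mathbb X$ has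 a subsequence converging in the target space. -/

import Mathlib

open MeasureTheory Filter Topology
open scoped ENNReal NNReal ContDiff

noncomputable section

/-- The fractional critical exponent `2N / (N - 2α)`. -/
def fracCritExp (N : ℕ) (α : ℝ) : ℝ := 2 * (N : ℝ) / ((N : ℝ) - 2 * α)

/-- The square of the Gagliardo seminorm,
`∬ |u x - u y| ^ 2 / |x - y| ^ (N + 2α) dx dy`, with values in `[0, ∞]`. -/
def gagliardoSq {N : ℕ} (α : ℝ) (u : EuclideanSpace ℝ (Fin N) → ℝ) : ℝ≥0∞ :=
  ∫⁻ p : EuclideanSpace ℝ (Fin N) × EuclideanSpace ℝ (Fin N),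
    ENNReal.ofReal (|u p.1 - u p.2| ^ 2 / ‖p.1 - p.2‖ ^ ((N : ℝ) + 2 * α))

/-- The Gagliardo seminorm, with values in `[0, ∞]`. -/
def gagliardo {N : ℕ} (α : ℝ) (u : EuclideanSpace ℝ (Fin N) → ℝ) : ℝ≥0∞ :=
  gagliardoSq α u ^ (1 / 2 : ℝ)

/-- The space `D^{α,2}(ℝ^N)`: the closure of `C_c^∞(ℝ^N)` with respect to the Gagliardo seminorm.
The closure is taken among the functions in `L^{2N/(N-2α)}`, where the seminorm separates points
(it vanishes on constants), so that this is the usual realisation of the completion of `C_c^∞`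
as a space of functions. -/
def fracD (N : ℕ) (α : ℝ) : Set (EuclideanSpace ℝ (Fin N) → ℝ) :=
  {u | MemLp u (ENNReal.ofReal (fracCritExp N α)) volume ∧
    ∃ φ : ℕ → EuclideanSpace ℝ (Fin N) → ℝ,
      (∀ n, ContDiff ℝ ∞ (φ n) ∧ HasCompactSupport (φ n)) ∧
      Tendsto (fun n => gagliardo α (fun x => u x - φ n x)) atTop (𝓝 0)}

/-- `∫ V |u|^2 dx`, with values in `[0, ∞]` (used for positive `V`). -/
def potentialEnergy {N : ℕ} (V u : EuclideanSpace ℝ (Fin N) → ℝ) : ℝ≥0∞ :=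
  ∫⁻ x, ENNReal.ofReal (V x * |u x| ^ 2)

/-- The space of all `u ∈ D^{α,2}(ℝ^N)` with `∫ V |u|^2 dx < ∞`. -/
def spaceX (N : ℕ) (α : ℝ) (V : EuclideanSpace ℝ (Fin N) → ℝ) :
    Set (EuclideanSpace ℝ (Fin N) → ℝ) :=
  {u | u ∈ fracD N α ∧ potentialEnergy V u < ⊤}

/-- The norm of `spaceX`: `‖u‖^2 = [u]^2 + ∫ V |u|^2 dx`. -/
def normX {N : ℕ} (α : ℝ) (V u : EuclideanSpace ℝ (Fin N) → ℝ) : ℝ≥0∞ :=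
  (gagliardoSq α u + potentialEnergy V u) ^ (1 / 2 : ℝ)

/-- The norm of the weighted Lebesgue space: `(∫ K |u|^q dx)^(1/q)`. -/
def normLK {N : ℕ} (K : EuclideanSpace ℝ (Fin N) → ℝ) (q : ℝ)
    (u : EuclideanSpace ℝ (Fin N) → ℝ) : ℝ≥0∞ :=
  (∫⁻ x, ENNReal.ofReal (K x * |u x| ^ q)) ^ (1 / q)

/-- The weighted Lebesgue space `L^q_K(ℝ^N)`: (Lebesgue) measurable `u` with
`∫ K |u|^q dx < ∞`. -/
def spaceLK {N : ℕ} (K : EuclideanSpace ℝ (Fin N) → ℝ) (q : ℝ) :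
    Set (EuclideanSpace ℝ (Fin N) → ℝ) :=
  {u | AEMeasurable u volume ∧ ∫⁻ x, ENNReal.ofReal (K x * |u x| ^ q) < ⊤}

/-- `X`, with norm `nX`, is compactly embedded into `Y`, with norm `nY`: it is contained in `Y`,
the inclusion is continuous, and every sequence that is bounded in `X` has a subsequence that
converges in `Y`. -/
def CompactlyEmbedded {E : Type*} (X : Set (E → ℝ)) (nX : (E → ℝ) → ℝ≥0∞)
    (Y : Set (E → ℝ)) (nY : (E → ℝ) → ℝ≥0∞) : Prop :=
  X ⊆ Y ∧
  (∃ C : ℝ≥0, ∀ u ∈ X, nY u ≤ C * nX u) ∧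
  ∀ u : ℕ → E → ℝ, (∀ n, u n ∈ X) → (∃ M : ℝ≥0, ∀ n, nX (u n) ≤ M) →
    ∃ w ∈ Y, ∃ k : ℕ → ℕ, StrictMono k ∧
      Tendsto (fun n => nY (fun x => u (k n) x - w x)) atTop (𝓝 0)

/-- `V` and `K` are positive, and `K ∈ L^∞`. -/
def VK1 {N : ℕ} (V K : EuclideanSpace ℝ (Fin N) → ℝ) : Prop :=
  (∀ x, 0 < V x ∧ 0 < K x) ∧ MemLp K ⊤ volume

/-- For Borel sets `A n` of uniformly bounded measure, `∫_{A n \ B_r(0)} K dx → 0` as `r → ∞`,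
uniformly in `n`. -/
def VK2 {N : ℕ} (K : EuclideanSpace ℝ (Fin N) → ℝ) : Prop :=
  ∀ A : ℕ → Set (EuclideanSpace ℝ (Fin N)), (∀ n, MeasurableSet (A n)) →
    ∀ R : ℝ, 0 < R → (∀ n, volume (A n) ≤ ENNReal.ofReal R) →
      TendstoUniformly (fun (r : ℝ) (n : ℕ) => ∫ x in A n ∩ (Metric.ball 0 r)ᶜ, K x)
        (fun _ => 0) atTop

/-- `K / V ∈ L^∞`. -/
def VK3 {N : ℕ} (V K : EuclideanSpace ℝ (Fin N) → ℝ) : Prop :=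
  MemLp (fun x => K x / V x) ⊤ volume

/-- The exponent `m` lies in `(2, 2*)` and `K / V ^ ((2* - m) / (2* - 2)) → 0` as `|x| → ∞`,
where `2* = 2N / (N - 2α)`. -/
def VK4With {N : ℕ} (α : ℝ) (V K : EuclideanSpace ℝ (Fin N) → ℝ) (m : ℝ) : Prop :=
  m ∈ Set.Ioo 2 (fracCritExp N α) ∧
  Tendsto (fun x => K x / V x ^ ((fracCritExp N α - m) / (fracCritExp N α - 2)))
    (cocompact (EuclideanSpace ℝ (Fin N))) (𝓝 0)

/-- The class of admissible pairs of (continuous) potentials. -/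
def ClassK {N : ℕ} (α : ℝ) (V K : EuclideanSpace ℝ (Fin N) → ℝ) : Prop :=
  Continuous V ∧ Continuous K ∧ VK1 V K ∧ VK2 K ∧ (VK3 V K ∨ ∃ m, VK4With α V K m)

end

/-! Write `p` for the critical exponent, `G x` for the inner Gagliardo integral and `A` for a
constant. Everything rests on a pointwise Poincaré inequality, `enorm_sub_setAverage_ball_le`: on a
ball of radius `h`, the squared distance of `u x` from the mean of `u` is at most `A h^(2α) G x`.

With balls centred at `x` and an optimal radius it gives the fractional Sobolev inequality. With a
finite cover by small balls it gives local compactness: in `L²` of a bounded ball, functions of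
bounded seminorm are controlled up to a small error by finitely many means, and these converge along
a diagonal subsequence.

For `2 < q < p` put `θ = (p - q)/(p - 2)`, so that `q = 2θ + p(1 - θ)`. Either alternative on the
potentials gives `K ≤ c V^θ`, and Hölder's inequality (`lintegral_weight_rpow_le`) turns this into
the continuous embedding. Either one also makes `∫ K |v|^q` uniformly small near infinity on bounded
sets (`UniformTail`): for `VK4With` by the same interpolation with a small constant, for `VK3` by
separating small, medium and large values of `|v|`, the medium ones being handled by `VK2`.

Compactness follows in `compactlyEmbedded_spaceX`: the subsequence is Cauchy in `L^q_K`, by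
interpolation between `L²` and `L^p` on a large ball and by the tail bound outside, and `L^q_K` is
complete. No weak limits are involved. -/

/-! ### Means over balls and a pointwise fractional Poincaré inequality. -/

/-- The inner integral of the Gagliardo seminorm. -/
noncomputable def gagliardoDensity {N : ℕ} (α : ℝ) (u : EuclideanSpace ℝ (Fin N) → ℝ)
    (x : EuclideanSpace ℝ (Fin N)) : ℝ≥0∞ :=
  ∫⁻ y, ENNReal.ofReal (|u x - u y| ^ 2 / ‖x - y‖ ^ ((N : ℝ) + 2 * α))

theorem enorm_integral_rpow_le {X : Type*} [MeasurableSpace X] {μ : Measure X}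
    [IsProbabilityMeasure μ] {f : X → ℝ} (hf : AEStronglyMeasurable f μ) {p : ℝ} (hp : 1 ≤ p) :
    ‖∫ x, f x ∂μ‖ₑ ^ p ≤ ∫⁻ x, ‖f x‖ₑ ^ p ∂μ := by
  have hp0 : 0 < p := by linarith
  have h1 : ‖∫ x, f x ∂μ‖ₑ ≤ eLpNorm f (ENNReal.ofReal p) μ := by
    refine (enorm_integral_le_lintegral_enorm f).trans ?_
    rw [← eLpNorm_one_eq_lintegral_enorm]
    exact eLpNorm_le_eLpNorm_of_exponent_le (by simpa using hp) hf
  refine (ENNReal.rpow_le_rpow h1 hp0.le).trans ?_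
  rw [eLpNorm_eq_lintegral_rpow_enorm_toReal (by simpa using hp0) ENNReal.ofReal_ne_top,
    ENNReal.toReal_ofReal hp0.le, ← ENNReal.rpow_mul, one_div, inv_mul_cancel₀ hp0.ne',
    ENNReal.rpow_one]

theorem enorm_setAverage_rpow_le {X : Type*} [MeasurableSpace X] {μ : Measure X} {s : Set X}
    (hs0 : μ s ≠ 0) (hs : μ s ≠ ⊤) {f : X → ℝ} (hf : AEStronglyMeasurable f μ) {p : ℝ}
    (hp : 1 ≤ p) :
    ‖⨍ x in s, f x ∂μ‖ₑ ^ p ≤ (μ s)⁻¹ * ∫⁻ x in s, ‖f x‖ₑ ^ p ∂μ := by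
  rw [setAverage_eq']
  have : IsProbabilityMeasure ((μ s)⁻¹ • μ.restrict s) :=
    ⟨by simp [ENNReal.inv_mul_cancel hs0 hs]⟩
  refine (enorm_integral_rpow_le (hf.restrict.smul_measure _) hp).trans ?_
  simp [lintegral_smul_measure]

theorem volume_euclidean_ball {N : ℕ} (c : EuclideanSpace ℝ (Fin N)) {h : ℝ} (hh : 0 < h) :
    volume (Metric.ball c h) =
      ENNReal.ofReal (h ^ N) * volume (Metric.ball (0 : EuclideanSpace ℝ (Fin N)) 1) := by
  rw [Measure.addHaar_ball_of_pos _ _ hh]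
  simp

/-- Two points of the ball are at distance at most `2h`, so there the Gagliardo kernel is at least
`(2h)^(-(N + 2α))`. -/
theorem setLIntegral_ball_sub_sq_le {N : ℕ} {α : ℝ} (hα : 0 ≤ α)
    (u : EuclideanSpace ℝ (Fin N) → ℝ)
    {c x : EuclideanSpace ℝ (Fin N)} {h : ℝ} (hx : x ∈ Metric.ball c h) :
    ∫⁻ y in Metric.ball c h, ‖u x - u y‖ₑ ^ (2 : ℝ) ≤
      ENNReal.ofReal ((2 * h) ^ ((N : ℝ) + 2 * α)) * gagliardoDensity α u x := by
  have hs : 0 ≤ (N : ℝ) + 2 * α := by positivity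
  have h0 : 0 < h := Metric.pos_of_mem_ball hx
  rw [gagliardoDensity, ← lintegral_const_mul' _ _ ENNReal.ofReal_ne_top]
  refine (setLIntegral_mono' measurableSet_ball ?_).trans (setLIntegral_le_lintegral _ _)
  intro y hy
  rw [← ENNReal.ofReal_mul (by positivity), Real.enorm_eq_ofReal_abs,
    ENNReal.ofReal_rpow_of_nonneg (abs_nonneg _) (by norm_num)]
  refine ENNReal.ofReal_le_ofReal ?_
  rw [Real.rpow_two]
  rcases eq_or_ne x y with rfl | hxy
  · simp
  have hpos : 0 < ‖x - y‖ := norm_pos_iff.2 (sub_ne_zero.2 hxy)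
  have hle : ‖x - y‖ ≤ 2 * h := by
    have := dist_triangle_right x y c
    rw [Metric.mem_ball] at hx hy
    rw [← dist_eq_norm]; linarith
  have h1 : ‖x - y‖ ^ ((N : ℝ) + 2 * α) ≤ (2 * h) ^ ((N : ℝ) + 2 * α) :=
    Real.rpow_le_rpow hpos.le hle hs
  have h2 : 0 < ‖x - y‖ ^ ((N : ℝ) + 2 * α) := Real.rpow_pos_of_pos hpos _
  rw [mul_div_assoc', le_div_iff₀ h2, mul_comm]
  exact mul_le_mul_of_nonneg_right h1 (by positivity)

/-- The constant in `enorm_sub_setAverage_ball_le`. -/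
noncomputable def ballPoincareConst (N : ℕ) (α : ℝ) : ℝ :=
  2 ^ ((N : ℝ) + 2 * α) * (volume (Metric.ball (0 : EuclideanSpace ℝ (Fin N)) 1)).toReal⁻¹

theorem ballPoincareConst_pos (N : ℕ) (α : ℝ) : 0 < ballPoincareConst N α := by
  have : 0 < (volume (Metric.ball (0 : EuclideanSpace ℝ (Fin N)) 1)).toReal :=
    ENNReal.toReal_pos (Metric.measure_ball_pos _ _ one_pos).ne' measure_ball_lt_top.ne
  unfold ballPoincareConst
  positivity

/-- The left side is the mean over `y` of `u x - u y`; Jensen's inequality moves the square inside.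
The volume `h^N |B₁|` cancels against `(2h)^(N + 2α)`, leaving `h^(2α)`. The centre `c` is free: the
Sobolev inequality takes `c = x`, local compactness takes the centres of a fixed cover. -/
theorem enorm_sub_setAverage_ball_le {N : ℕ} {α : ℝ} (hα : 0 ≤ α)
    {u : EuclideanSpace ℝ (Fin N) → ℝ} (hu : AEStronglyMeasurable u volume)
    {c x : EuclideanSpace ℝ (Fin N)} {h : ℝ} (hx : x ∈ Metric.ball c h)
    (hint : IntegrableOn u (Metric.ball c h)) :
    ‖u x - ⨍ y in Metric.ball c h, u y‖ₑ ^ (2 : ℝ) ≤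
      ENNReal.ofReal (ballPoincareConst N α * h ^ (2 * α)) * gagliardoDensity α u x := by
  have h0 : 0 < h := Metric.pos_of_mem_ball hx
  have hb0 : volume (Metric.ball c h) ≠ 0 := (Metric.measure_ball_pos _ _ h0).ne'
  have hbt : volume (Metric.ball c h) ≠ ⊤ := measure_ball_lt_top.ne
  have e1 : u x - ⨍ y in Metric.ball c h, u y = ⨍ y in Metric.ball c h, (u x - u y) := by
    have hr : volume.real (Metric.ball c h) ≠ 0 := (ENNReal.toReal_pos hb0 hbt).ne'
    have hc : Integrable (fun _ => u x) (volume.restrict (Metric.ball c h)) :=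
      integrableOn_const hbt enorm_ne_top
    rw [setAverage_eq, setAverage_eq, integral_sub hc hint]
    simp only [integral_const, MeasurableSet.univ, smul_eq_mul, measureReal_restrict_apply,
      Set.univ_inter]
    field_simp
  rw [e1]
  refine (enorm_setAverage_rpow_le hb0 hbt (aestronglyMeasurable_const.sub hu)
    (by norm_num)).trans ?_
  refine (mul_le_mul_right (setLIntegral_ball_sub_sq_le hα u hx) _).trans ?_
  rw [← mul_assoc]
  refine mul_le_mul_left (le_of_eq ?_) _
  have hω0 : volume (Metric.ball (0 : EuclideanSpace ℝ (Fin N)) 1) ≠ 0 :=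
    (Metric.measure_ball_pos _ _ one_pos).ne'
  have hωt : volume (Metric.ball (0 : EuclideanSpace ℝ (Fin N)) 1) ≠ ⊤ := measure_ball_lt_top.ne
  have hω : 0 < (volume (Metric.ball (0 : EuclideanSpace ℝ (Fin N)) 1)).toReal :=
    ENNReal.toReal_pos hω0 hωt
  rw [volume_euclidean_ball c h0, ballPoincareConst]
  conv_lhs => rw [← ENNReal.ofReal_toReal hωt]
  rw [← ENNReal.ofReal_mul (by positivity), ← ENNReal.ofReal_inv_of_pos (by positivity),
    ← ENNReal.ofReal_mul (by positivity)]
  congr 1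
  rw [Real.mul_rpow (by norm_num) h0.le, Real.rpow_add h0, Real.rpow_natCast]
  field_simp

/-! ### The fractional Sobolev inequality. -/

/-- The radius with `r^N = J/g` balances the two terms, since then `r^(2α - N) J = r^(2α) g`. -/
theorem rpow_le_of_forall_scale {N α t a b g J : ℝ} (hα : 0 < α) (hN : 2 * α < N) (ht : 0 ≤ t)
    (ha : 0 ≤ a) (hb : 0 ≤ b) (hg : 0 < g) (hJ : 0 < J)
    (h : ∀ r : ℝ, 0 < r → t ^ 2 ≤ a * r ^ (2 * α) * g + b * r ^ (2 * α - N) * J) :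
    t ^ (2 * N / (N - 2 * α)) ≤
      (a + b) ^ (N / (N - 2 * α)) * g * J ^ (N / (N - 2 * α) - 1) := by
  have hNp : 0 < N := by linarith
  have hd : 0 < N - 2 * α := by linarith
  set r : ℝ := (J / g) ^ (1 / N) with hr
  have hr0 : 0 < r := Real.rpow_pos_of_pos (div_pos hJ hg) _
  have hrN : r ^ N = J / g := by
    rw [hr, ← Real.rpow_mul (div_pos hJ hg).le, one_div, inv_mul_cancel₀ hNp.ne', Real.rpow_one]
  have h1 : t ^ 2 ≤ (a + b) * (g * r ^ (2 * α)) := by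
    refine (h r hr0).trans (le_of_eq ?_)
    rw [Real.rpow_sub hr0, hrN]
    field_simp
  have h2 : t ^ (2 * N / (N - 2 * α)) = (t ^ 2) ^ (N / (N - 2 * α)) := by
    rw [← Real.rpow_natCast t 2, ← Real.rpow_mul ht]
    congr 1; push_cast; ring
  have h3 : (g * r ^ (2 * α)) ^ (N / (N - 2 * α)) = g * J ^ (N / (N - 2 * α) - 1) := by
    have e : 1 / N * (2 * α) * (N / (N - 2 * α)) = N / (N - 2 * α) - 1 := by
      field_simp; ring
    rw [Real.mul_rpow hg.le (Real.rpow_nonneg hr0.le _), hr,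
      ← Real.rpow_mul (div_pos hJ hg).le, ← Real.rpow_mul (div_pos hJ hg).le, e,
      Real.div_rpow hJ.le hg.le, Real.rpow_sub_one hg.ne']
    have := Real.rpow_pos_of_pos hg (N / (N - 2 * α))
    field_simp
  rw [h2, mul_assoc, ← h3, ← Real.mul_rpow (by positivity) (by positivity)]
  exact Real.rpow_le_rpow (by positivity) h1 (by positivity)

theorem aemeasurable_gagliardo_integrand {N : ℕ} (α : ℝ) {u : EuclideanSpace ℝ (Fin N) → ℝ}
    (hu : AEMeasurable u volume) :
    AEMeasurable (fun p : EuclideanSpace ℝ (Fin N) × EuclideanSpace ℝ (Fin N) =>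
      ENNReal.ofReal (|u p.1 - u p.2| ^ 2 / ‖p.1 - p.2‖ ^ ((N : ℝ) + 2 * α))) volume := by
  have h1 : AEMeasurable (fun p : EuclideanSpace ℝ (Fin N) × EuclideanSpace ℝ (Fin N) => u p.1)
      volume := hu.comp_quasiMeasurePreserving Measure.quasiMeasurePreserving_fst
  have h2 : AEMeasurable (fun p : EuclideanSpace ℝ (Fin N) × EuclideanSpace ℝ (Fin N) => u p.2)
      volume := hu.comp_quasiMeasurePreserving Measure.quasiMeasurePreserving_snd
  have h3 : Measurable (fun p : EuclideanSpace ℝ (Fin N) × EuclideanSpace ℝ (Fin N) =>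
      ‖p.1 - p.2‖ ^ ((N : ℝ) + 2 * α)) := by fun_prop
  simp only [sq_abs]
  exact (((h1.sub h2).pow_const 2).div h3.aemeasurable).ennreal_ofReal

theorem lintegral_gagliardoDensity {N : ℕ} (α : ℝ) {u : EuclideanSpace ℝ (Fin N) → ℝ}
    (hu : AEMeasurable u volume) : ∫⁻ x, gagliardoDensity α u x = gagliardoSq α u := by
  have h := aemeasurable_gagliardo_integrand α hu
  rw [gagliardoSq, Measure.volume_eq_prod, lintegral_prod]
  · rfl
  · rwa [← Measure.volume_eq_prod]

theorem two_lt_fracCritExp {N : ℕ} {α : ℝ} (hα : 0 < α) (hN : 2 * α < (N : ℝ)) :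
    2 < fracCritExp N α := by
  rw [fracCritExp, lt_div_iff₀ (by linarith)]
  linarith

theorem MeasureTheory.MemLp.integrableOn_ball {N : ℕ} {p : ℝ≥0∞} (hp : 1 ≤ p)
    {u : EuclideanSpace ℝ (Fin N) → ℝ}
    (hu : MemLp u p volume) (c : EuclideanSpace ℝ (Fin N)) (h : ℝ) :
    IntegrableOn u (Metric.ball c h) volume := by
  have : IsFiniteMeasure (volume.restrict (Metric.ball c h)) :=
    ⟨by simpa using measure_ball_lt_top⟩
  exact (hu.restrict _).integrable hp

theorem ofReal_one_le {p : ℝ} (hp : 2 < p) : 1 ≤ ENNReal.ofReal p := by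
  rw [ENNReal.one_le_ofReal]; linarith

theorem lintegral_enorm_rpow_lt_top {N : ℕ} {p : ℝ} (hp : 0 < p)
    {u : EuclideanSpace ℝ (Fin N) → ℝ} (hu : MemLp u (ENNReal.ofReal p) volume) :
    ∫⁻ x, ‖u x‖ₑ ^ p < ⊤ := by
  have := lintegral_rpow_enorm_lt_top_of_eLpNorm_lt_top (by simpa using hp)
    ENNReal.ofReal_ne_top hu.2
  rwa [ENNReal.toReal_ofReal hp.le] at this

theorem enorm_setAverage_ball_rpow_le {N : ℕ} {p : ℝ} (hp : 1 ≤ p)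
    {u : EuclideanSpace ℝ (Fin N) → ℝ} (hu : AEStronglyMeasurable u volume)
    (c : EuclideanSpace ℝ (Fin N)) {h : ℝ} (hh : 0 < h) :
    ‖⨍ y in Metric.ball c h, u y‖ₑ ^ p ≤ ENNReal.ofReal (h ^ N *
      (volume (Metric.ball (0 : EuclideanSpace ℝ (Fin N)) 1)).toReal)⁻¹ * ∫⁻ x, ‖u x‖ₑ ^ p := by
  have hb0 : volume (Metric.ball c h) ≠ 0 := (Metric.measure_ball_pos _ _ hh).ne'
  have hbt : volume (Metric.ball c h) ≠ ⊤ := measure_ball_lt_top.ne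
  have hω0 : volume (Metric.ball (0 : EuclideanSpace ℝ (Fin N)) 1) ≠ 0 :=
    (Metric.measure_ball_pos _ _ one_pos).ne'
  have hωt : volume (Metric.ball (0 : EuclideanSpace ℝ (Fin N)) 1) ≠ ⊤ := measure_ball_lt_top.ne
  have hω := ENNReal.toReal_pos hω0 hωt
  refine (enorm_setAverage_rpow_le hb0 hbt hu hp).trans ?_
  rw [ENNReal.ofReal_inv_of_pos (by positivity), ENNReal.ofReal_mul (by positivity),
    ENNReal.ofReal_toReal hωt, ← volume_euclidean_ball c hh]
  gcongr
  exact Measure.restrict_le_self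

theorem enorm_rpow_eq_ofReal (a : ℝ) {p : ℝ} (hp : 0 ≤ p) :
    ‖a‖ₑ ^ p = ENNReal.ofReal (|a| ^ p) := by
  rw [Real.enorm_eq_ofReal_abs, ENNReal.ofReal_rpow_of_nonneg (abs_nonneg _) hp]

/-- The fractional Sobolev inequality. -/
theorem exists_fractional_sobolev_const {N : ℕ} {α : ℝ} (hα : 0 < α) (hN : 2 * α < (N : ℝ)) :
    ∃ C : ℝ, 0 < C ∧ ∀ u : EuclideanSpace ℝ (Fin N) → ℝ,
      MemLp u (ENNReal.ofReal (fracCritExp N α)) volume →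
      ∫⁻ x, ‖u x‖ₑ ^ fracCritExp N α ≤
        ENNReal.ofReal C * gagliardoSq α u ^ (fracCritExp N α / 2) := by
  have hp2 := two_lt_fracCritExp hα hN
  set p := fracCritExp N α with hp
  have hp0 : 0 < p := by linarith
  have hd : 0 < (N : ℝ) - 2 * α := by linarith
  have hN0 : 0 < (N : ℝ) := by linarith
  have hpN : p / 2 = N / (N - 2 * α) := by rw [hp, fracCritExp]; ring
  have hpN' : -(N : ℝ) * (2 / p) = 2 * α - N := by
    rw [hp, fracCritExp]; field_simp; ring
  have hω : 0 < (volume (Metric.ball (0 : EuclideanSpace ℝ (Fin N)) 1)).toReal :=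
    ENNReal.toReal_pos (Metric.measure_ball_pos _ _ one_pos).ne' measure_ball_lt_top.ne
  set v₁ := (volume (Metric.ball (0 : EuclideanSpace ℝ (Fin N)) 1)).toReal with hv₁
  have hA := ballPoincareConst_pos N α
  set A := ballPoincareConst N α with hAdef
  set C₀ : ℝ := (2 * A + 2 * v₁⁻¹ ^ (2 / p)) ^ (p / 2) with hC₀
  have hC₀p : 0 < C₀ := by positivity
  refine ⟨C₀ ^ (p / 2), by positivity, fun u hu => ?_⟩
  have hum := hu.1
  have hItop := lintegral_enorm_rpow_lt_top hp0 hu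
  rcases eq_or_ne (∫⁻ x, ‖u x‖ₑ ^ p) 0 with hI0 | hI0
  · simp [hI0]
  obtain ⟨I, hI⟩ : ∃ I : ℝ, I = (∫⁻ x, ‖u x‖ₑ ^ p).toReal := ⟨_, rfl⟩
  have hIpos : 0 < I := hI ▸ ENNReal.toReal_pos hI0 hItop.ne
  have hIe : ∫⁻ x, ‖u x‖ₑ ^ p = ENNReal.ofReal I := by rw [hI, ENNReal.ofReal_toReal hItop.ne]
  have hJpos : 0 < I ^ (2 / p) := Real.rpow_pos_of_pos hIpos _
  have key : ∀ x, ‖u x‖ₑ ^ p ≤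
      ENNReal.ofReal (C₀ * (I ^ (2 / p)) ^ (p / 2 - 1)) * gagliardoDensity α u x := by
    intro x
    have hc : 0 < C₀ * (I ^ (2 / p)) ^ (p / 2 - 1) := by positivity
    rcases eq_or_ne (gagliardoDensity α u x) ⊤ with hG | hG
    · rw [hG, ENNReal.mul_top (by simpa using hc)]
      exact le_top
    obtain ⟨g, hg⟩ : ∃ g : ℝ, g = (gagliardoDensity α u x).toReal := ⟨_, rfl⟩
    have hg0 : 0 ≤ g := hg ▸ ENNReal.toReal_nonneg
    have hGe : gagliardoDensity α u x = ENNReal.ofReal g := by rw [hg, ENNReal.ofReal_toReal hG]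
    rw [hGe, ← ENNReal.ofReal_mul hc.le, enorm_rpow_eq_ofReal _ hp0.le]
    refine ENNReal.ofReal_le_ofReal ?_
    -- The density may vanish at `x`, whereas the optimal radius needs a positive one; hence `g +
    -- δ`, with `δ → 0` afterwards.
    have hδ : ∀ δ : ℝ, 0 < δ →
        |u x| ^ p ≤ C₀ * (g + δ) * (I ^ (2 / p)) ^ (p / 2 - 1) := by
      intro δ hδ
      have := rpow_le_of_forall_scale (N := N) (α := α) (t := |u x|) (a := 2 * A)
        (b := 2 * v₁⁻¹ ^ (2 / p)) (g := g + δ) (J := I ^ (2 / p)) hα hN (abs_nonneg _)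
        (by positivity) (by positivity) (by positivity) hJpos ?_
      · rw [← hpN] at this
        exact this
      intro r hr
      have hxr : x ∈ Metric.ball x r := Metric.mem_ball_self hr
      have h1 := enorm_sub_setAverage_ball_le hα.le hum hxr
        (hu.integrableOn_ball (ofReal_one_le hp2) x r)
      have h2 := enorm_setAverage_ball_rpow_le (p := p) (by linarith) hum x hr
      set m := ⨍ y in Metric.ball x r, u y with hm
      rw [hGe, ← ENNReal.ofReal_mul (by positivity), enorm_rpow_eq_ofReal _ (by norm_num),
        ENNReal.ofReal_le_ofReal_iff (by positivity), Real.rpow_two, sq_abs] at h1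
      rw [hIe, ← ENNReal.ofReal_mul (by positivity), enorm_rpow_eq_ofReal _ hp0.le,
        ENNReal.ofReal_le_ofReal_iff (by positivity)] at h2
      have h3 : m ^ 2 ≤ v₁⁻¹ ^ (2 / p) * (r ^ (2 * α - N) * I ^ (2 / p)) := by
        have h4 := Real.rpow_le_rpow (by positivity) h2 (by positivity : 0 ≤ 2 / p)
        rw [← Real.rpow_mul (abs_nonneg _), mul_div_cancel₀ _ hp0.ne', Real.rpow_two,
          sq_abs] at h4
        refine h4.trans (le_of_eq ?_)
        rw [Real.mul_rpow (by positivity) hIpos.le, mul_inv, Real.mul_rpow (by positivity)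
          (by positivity), ← hpN', Real.rpow_mul hr.le, Real.rpow_neg hr.le, Real.rpow_natCast]
        ring
      have h5 : 0 ≤ A * r ^ (2 * α) * δ := by positivity
      rw [sq_abs]
      -- This is `u² ≤ 2(u - m)² + 2m²`, the source of the factors 2 in `C₀`.
      nlinarith [sq_nonneg (u x - m - m)]
    have hlim : Tendsto (fun δ : ℝ => C₀ * (g + δ) * (I ^ (2 / p)) ^ (p / 2 - 1)) (𝓝[>] 0)
        (𝓝 (C₀ * (g + 0) * (I ^ (2 / p)) ^ (p / 2 - 1))) := by
      refine Tendsto.mono_left ?_ nhdsWithin_le_nhds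
      exact Continuous.tendsto (by fun_prop) 0
    have := ge_of_tendsto hlim (eventually_nhdsWithin_of_forall fun δ hδ' => hδ δ hδ')
    calc |u x| ^ p ≤ _ := this
      _ = _ := by ring
  have hint := lintegral_mono (μ := volume) key
  rw [lintegral_const_mul' _ _ ENNReal.ofReal_ne_top,
    lintegral_gagliardoDensity α hum.aemeasurable, hIe] at hint
  rw [hIe]
  rcases eq_or_ne (gagliardoSq α u) ⊤ with hS | hS
  · rw [hS, ENNReal.top_rpow_of_pos (by positivity), ENNReal.mul_top]
    · exact le_top
    · rw [ne_eq, ENNReal.ofReal_eq_zero, not_le]; positivity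
  obtain ⟨S, hSr⟩ : ∃ S : ℝ, S = (gagliardoSq α u).toReal := ⟨_, rfl⟩
  have hS0 : 0 ≤ S := hSr ▸ ENNReal.toReal_nonneg
  have hSe : gagliardoSq α u = ENNReal.ofReal S := by rw [hSr, ENNReal.ofReal_toReal hS]
  rw [hSe, ← ENNReal.ofReal_mul (by positivity), ENNReal.ofReal_le_ofReal_iff (by positivity)]
    at hint
  rw [hSe, ENNReal.ofReal_rpow_of_nonneg hS0 (by positivity), ← ENNReal.ofReal_mul (by positivity)]
  refine ENNReal.ofReal_le_ofReal ?_
  have e1 : (I ^ (2 / p)) ^ (p / 2 - 1) * I ^ (2 / p) = I := by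
    rw [← Real.rpow_mul hIpos.le, ← Real.rpow_add hIpos]
    have : 2 / p * (p / 2 - 1) + 2 / p = 1 := by field_simp; ring
    rw [this, Real.rpow_one]
  -- Integrating `key` gave `I ≤ C₀ S J^(p/2 - 1)` with `J = I^(2/p)`. Dividing is legitimate
  -- because `u ∈ L^p` makes `I` finite.
  have h6 : I ^ (2 / p) ≤ C₀ * S := by
    have hq : 0 < (I ^ (2 / p)) ^ (p / 2 - 1) := by positivity
    refine le_of_mul_le_mul_left ?_ hq
    rw [e1]
    linarith
  have h7 := Real.rpow_le_rpow hJpos.le h6 (by positivity : 0 ≤ p / 2)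
  rw [← Real.rpow_mul hIpos.le, Real.mul_rpow hC₀p.le hS0] at h7
  have : 2 / p * (p / 2) = 1 := by field_simp
  rwa [this, Real.rpow_one] at h7

/-! ### Weighted interpolation and the continuous embedding. -/

/-- Interpolation between a weighted `L²` norm and an `Lᵖ` norm. -/
theorem lintegral_weight_rpow_le {X : Type*} [MeasurableSpace X] {μ : Measure X}
    {K W v : X → ℝ} {p q c : ℝ} (hq : q ∈ Set.Ioo 2 p) (hc : 0 ≤ c)
    (hv : AEMeasurable v μ) (hW : AEMeasurable W μ) (hW0 : ∀ x, 0 ≤ W x)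
    (hK : ∀ᵐ x ∂μ, K x ≤ c * W x ^ ((p - q) / (p - 2))) :
    ∫⁻ x, ENNReal.ofReal (K x * |v x| ^ q) ∂μ ≤
      ENNReal.ofReal c * ((∫⁻ x, ENNReal.ofReal (W x * |v x| ^ 2) ∂μ) ^ ((p - q) / (p - 2)) *
        (∫⁻ x, ‖v x‖ₑ ^ p ∂μ) ^ ((q - 2) / (p - 2))) := by
  obtain ⟨hq1, hq2⟩ := hq
  have hd : 0 < p - 2 := by linarith
  have hθ : 0 ≤ (p - q) / (p - 2) := div_nonneg (by linarith) hd.le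
  have hθ' : 0 ≤ (q - 2) / (p - 2) := div_nonneg (by linarith) hd.le
  have hsum : (p - q) / (p - 2) + (q - 2) / (p - 2) = 1 := by field_simp; ring
  have hexp : 2 * ((p - q) / (p - 2)) + p * ((q - 2) / (p - 2)) = q := by field_simp; ring
  set θ := (p - q) / (p - 2)
  set θ' := (q - 2) / (p - 2)
  have hf : AEMeasurable (fun x => ENNReal.ofReal (W x * |v x| ^ 2)) μ := by
    simp only [sq_abs]
    exact (hW.mul (hv.pow_const 2)).ennreal_ofReal
  have hg : AEMeasurable (fun x => ‖v x‖ₑ ^ p) μ := hv.enorm.pow_const p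
  refine le_trans ?_ (mul_le_mul_right (ENNReal.lintegral_mul_norm_pow_le hf hg hθ hθ' hsum) _)
  rw [← lintegral_const_mul' _ _ ENNReal.ofReal_ne_top]
  refine lintegral_mono_ae ?_
  filter_upwards [hK] with x hx
  have hWx := hW0 x
  rw [ENNReal.ofReal_rpow_of_nonneg (by positivity) hθ, enorm_rpow_eq_ofReal _ (by linarith),
    ENNReal.ofReal_rpow_of_nonneg (by positivity) hθ', ← ENNReal.ofReal_mul (by positivity),
    ← ENNReal.ofReal_mul hc]
  refine ENNReal.ofReal_le_ofReal ?_
  have e : |v x| ^ q = (|v x| ^ 2) ^ θ * (|v x| ^ p) ^ θ' := by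
    rw [← Real.rpow_natCast, ← Real.rpow_mul (abs_nonneg _), ← Real.rpow_mul (abs_nonneg _),
      ← Real.rpow_add_of_nonneg (abs_nonneg _)]
    · congr 1
      push_cast
      exact hexp.symm
    · positivity
    · have : 0 < p := by linarith
      positivity
  rw [Real.mul_rpow hWx (by positivity), e]
  calc K x * ((|v x| ^ 2) ^ θ * (|v x| ^ p) ^ θ')
      ≤ c * W x ^ θ * ((|v x| ^ 2) ^ θ * (|v x| ^ p) ^ θ') := by gcongr
    _ = _ := by ring

theorem MeasureTheory.MemLp.exists_ae_le {X : Type*} [MeasurableSpace X] {μ : Measure X}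
    {f : X → ℝ} (hf : MemLp f ⊤ μ) : ∃ c : ℝ, 0 < c ∧ ∀ᵐ x ∂μ, f x ≤ c := by
  have h := hf.2
  rw [eLpNorm_exponent_top] at h
  refine ⟨(eLpNormEssSup f μ).toReal + 1, by positivity, ?_⟩
  filter_upwards [ae_le_eLpNormEssSup (f := f) (μ := μ)] with x hx
  have h1 : ‖f x‖ ≤ (eLpNormEssSup f μ).toReal := by
    have := ENNReal.toReal_mono h.ne hx
    simpa using this
  have := Real.le_norm_self (f x)
  linarith

/-- In `K = K^θ K^(1 - θ)` the first factor is controlled by `K/V ∈ L^∞`, the second by `K ∈ L^∞`.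
-/
theorem VK3.exists_ae_le_rpow {N : ℕ} {V K : EuclideanSpace ℝ (Fin N) → ℝ} (h1 : VK1 V K)
    (h3 : VK3 V K) {θ : ℝ} (hθ : 0 ≤ θ) (hθ' : θ ≤ 1) :
    ∃ c : ℝ, 0 < c ∧ ∀ᵐ x, K x ≤ c * V x ^ θ := by
  obtain ⟨c₀, hc₀, hK⟩ := h1.2.exists_ae_le
  obtain ⟨c₁, hc₁, hKV⟩ := MemLp.exists_ae_le h3
  refine ⟨c₁ ^ θ * c₀ ^ (1 - θ), by positivity, ?_⟩
  filter_upwards [hK, hKV] with x hx hx'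
  have hVx := (h1.1 x).1
  have hKx := (h1.1 x).2
  rw [div_le_iff₀ hVx] at hx'
  calc K x = K x ^ θ * K x ^ (1 - θ) := by
        rw [← Real.rpow_add hKx, add_sub_cancel, Real.rpow_one]
    _ ≤ (c₁ * V x) ^ θ * c₀ ^ (1 - θ) := by
        have : 0 ≤ 1 - θ := by linarith
        gcongr
    _ = _ := by rw [Real.mul_rpow hc₁.le hVx.le]; ring

/-- The ratio is below 1 off a compact set and, being continuous, bounded on it. -/
theorem exists_forall_le_rpow_of_tendsto {N : ℕ} {V K : EuclideanSpace ℝ (Fin N) → ℝ}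
    (hV : Continuous V) (hK : Continuous K) (hV0 : ∀ x, 0 < V x) {θ : ℝ}
    (h : Tendsto (fun x => K x / V x ^ θ) (cocompact (EuclideanSpace ℝ (Fin N))) (𝓝 0)) :
    ∃ c : ℝ, 0 < c ∧ ∀ x, K x ≤ c * V x ^ θ := by
  have hcont : Continuous fun x => K x / V x ^ θ :=
    hK.div (hV.rpow_const fun x => Or.inl (hV0 x).ne') fun x =>
      (Real.rpow_pos_of_pos (hV0 x) _).ne'
  have h1 := h.eventually (gt_mem_nhds one_pos)
  obtain ⟨t, ht, hts⟩ := mem_cocompact.1 h1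
  obtain ⟨c, hc⟩ := ht.bddAbove_image hcont.continuousOn
  refine ⟨max c 1, by positivity, fun x => ?_⟩
  rw [← div_le_iff₀ (Real.rpow_pos_of_pos (hV0 x) _)]
  by_cases hx : x ∈ t
  · exact (hc (Set.mem_image_of_mem _ hx)).trans (le_max_left _ _)
  · exact (le_of_lt (hts hx)).trans (le_max_right _ _)

theorem memLp_of_mem_spaceX {N : ℕ} {α : ℝ} {V u : EuclideanSpace ℝ (Fin N) → ℝ}
    (hu : u ∈ spaceX N α V) : MemLp u (ENNReal.ofReal (fracCritExp N α)) volume := hu.1.1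

theorem gagliardoSq_le_normX_sq {N : ℕ} (α : ℝ) (V u : EuclideanSpace ℝ (Fin N) → ℝ) :
    gagliardoSq α u ≤ normX α V u ^ (2 : ℝ) := by
  rw [normX, ← ENNReal.rpow_mul]
  norm_num

theorem potentialEnergy_le_normX_sq {N : ℕ} (α : ℝ) (V u : EuclideanSpace ℝ (Fin N) → ℝ) :
    potentialEnergy V u ≤ normX α V u ^ (2 : ℝ) := by
  rw [normX, ← ENNReal.rpow_mul]
  norm_num

/-- If `K ≤ c V ^ θ` with the interpolation exponent `θ`, then `X` embeds into `L^q_K`. -/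
theorem spaceX_continuously_embedded {N : ℕ} {α : ℝ} (hα : 0 < α) (hN : 2 * α < (N : ℝ))
    {V K : EuclideanSpace ℝ (Fin N) → ℝ} (hV : Continuous V) (hV0 : ∀ x, 0 ≤ V x) {q c : ℝ}
    (hq : q ∈ Set.Ioo 2 (fracCritExp N α)) (hc : 0 < c)
    (hK : ∀ᵐ x, K x ≤ c * V x ^ ((fracCritExp N α - q) / (fracCritExp N α - 2))) :
    spaceX N α V ⊆ spaceLK K q ∧
      ∃ C : ℝ≥0, ∀ u ∈ spaceX N α V, normLK K q u ≤ C * normX α V u := by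
  obtain ⟨C, hC, hsob⟩ := exists_fractional_sobolev_const hα hN
  have hp2 := two_lt_fracCritExp hα hN
  set p := fracCritExp N α
  have hp0 : 0 < p := by linarith
  have hd : 0 < p - 2 := by linarith
  have hq0 : 0 < q := by linarith [hq.1]
  have hθ : 0 ≤ (p - q) / (p - 2) := div_nonneg (by linarith [hq.2]) hd.le
  have hθ' : 0 ≤ (q - 2) / (p - 2) := div_nonneg (by linarith [hq.1]) hd.le
  -- The interpolated bound is homogeneous of degree `q` in the norm, so its `q`-th root is linear.
  have hexp : 2 * ((p - q) / (p - 2)) + p * ((q - 2) / (p - 2)) = q := by field_simp; ring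
  have hint : ∀ u ∈ spaceX N α V, ∫⁻ x, ENNReal.ofReal (K x * |u x| ^ q) ≤
      ENNReal.ofReal c * (potentialEnergy V u ^ ((p - q) / (p - 2)) *
        (∫⁻ x, ‖u x‖ₑ ^ p) ^ ((q - 2) / (p - 2))) := fun u hu =>
    lintegral_weight_rpow_le hq hc.le (memLp_of_mem_spaceX hu).1.aemeasurable hV.aemeasurable hV0 hK
  refine ⟨fun u hu => ⟨(memLp_of_mem_spaceX hu).1.aemeasurable, (hint u hu).trans_lt ?_⟩, ?_⟩
  · exact ENNReal.mul_lt_top ENNReal.ofReal_lt_top (ENNReal.mul_lt_top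
      (ENNReal.rpow_lt_top_of_nonneg hθ hu.2.ne)
      (ENNReal.rpow_lt_top_of_nonneg hθ' (lintegral_enorm_rpow_lt_top hp0 (memLp_of_mem_spaceX hu)).ne))
  refine ⟨Real.toNNReal ((c * C ^ ((q - 2) / (p - 2))) ^ (1 / q)), fun u hu => ?_⟩
  have h1 := potentialEnergy_le_normX_sq α V u
  have h2 : ∫⁻ x, ‖u x‖ₑ ^ p ≤ ENNReal.ofReal C * normX α V u ^ p := by
    refine (hsob u (memLp_of_mem_spaceX hu)).trans ?_
    gcongr
    refine (ENNReal.rpow_le_rpow (gagliardoSq_le_normX_sq α V u) (by positivity)).trans ?_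
    rw [← ENNReal.rpow_mul]
    exact le_of_eq (by congr 1; ring)
  rw [normLK]
  refine (ENNReal.rpow_le_rpow (hint u hu) (by positivity)).trans ?_
  have h3 : ENNReal.ofReal c * (potentialEnergy V u ^ ((p - q) / (p - 2)) *
        (∫⁻ x, ‖u x‖ₑ ^ p) ^ ((q - 2) / (p - 2))) ≤
      ENNReal.ofReal (c * C ^ ((q - 2) / (p - 2))) * normX α V u ^ q := by
    calc _ ≤ ENNReal.ofReal c * ((normX α V u ^ (2 : ℝ)) ^ ((p - q) / (p - 2)) *
        (ENNReal.ofReal C * normX α V u ^ p) ^ ((q - 2) / (p - 2))) := by gcongr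
      _ = _ := by
        have e : normX α V u ^ q = normX α V u ^ (2 * ((p - q) / (p - 2))) *
            normX α V u ^ (p * ((q - 2) / (p - 2))) := by
          rw [← ENNReal.rpow_add_of_nonneg _ _ (by positivity) (by positivity), hexp]
        rw [ENNReal.mul_rpow_of_nonneg _ _ hθ', ← ENNReal.rpow_mul, ← ENNReal.rpow_mul,
          ENNReal.ofReal_mul hc.le, ENNReal.ofReal_rpow_of_nonneg hC.le hθ', e]
        ring
  refine (ENNReal.rpow_le_rpow h3 (by positivity)).trans (le_of_eq ?_)
  rw [ENNReal.mul_rpow_of_nonneg _ _ (by positivity), ← ENNReal.rpow_mul,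
    mul_one_div_cancel hq0.ne', ENNReal.rpow_one, ENNReal.ofReal_rpow_of_nonneg (by positivity)
    (by positivity)]
  rfl

/-! ### Uniform smallness near infinity. -/

/-- The integrals `∫ K |v| ^ q` are uniformly small near infinity, for `v` bounded in the weighted
`L²` norm and in `Lᵖ`. -/
def UniformTail {N : ℕ} (V K : EuclideanSpace ℝ (Fin N) → ℝ) (p q : ℝ) : Prop :=
  ∀ M ε : ℝ, 0 < M → 0 < ε → ∃ R : ℝ, 0 < R ∧ ∀ v : EuclideanSpace ℝ (Fin N) → ℝ,
    AEMeasurable v volume → potentialEnergy V v ≤ ENNReal.ofReal M →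
    ∫⁻ x, ‖v x‖ₑ ^ p ≤ ENNReal.ofReal M →
    ∫⁻ x in (Metric.ball 0 R)ᶜ, ENNReal.ofReal (K x * |v x| ^ q) ≤ ENNReal.ofReal ε

theorem uniformTail_of_tendsto {N : ℕ} {V K : EuclideanSpace ℝ (Fin N) → ℝ}
    (hV : Continuous V) (hV0 : ∀ x, 0 < V x) {p q : ℝ} (hq : q ∈ Set.Ioo 2 p)
    (h : Tendsto (fun x => K x / V x ^ ((p - q) / (p - 2)))
      (cocompact (EuclideanSpace ℝ (Fin N))) (𝓝 0)) : UniformTail V K p q := by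
  intro M ε hM hε
  have hd : 0 < p - 2 := by linarith [hq.1, hq.2]
  have hθ : 0 ≤ (p - q) / (p - 2) := div_nonneg (by linarith [hq.2]) hd.le
  have hθ' : 0 ≤ (q - 2) / (p - 2) := div_nonneg (by linarith [hq.1]) hd.le
  have hsum : (p - q) / (p - 2) + (q - 2) / (p - 2) = 1 := by field_simp; ring
  -- With `K ≤ (ε/M) V^θ` far out, both interpolation factors are powers of `M` with exponents
  -- adding up to 1, and `M` cancels.
  have h1 := h.eventually (gt_mem_nhds (div_pos hε hM))
  rw [← Metric.cobounded_eq_cocompact,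
    (Metric.hasBasis_cobounded_compl_closedBall (0 : EuclideanSpace ℝ (Fin N))).eventually_iff]
    at h1
  obtain ⟨r, -, hr⟩ := h1
  refine ⟨max r 0 + 1, by positivity, fun v hv hv1 hv2 => ?_⟩
  have hK : ∀ᵐ x ∂(volume.restrict (Metric.ball (0 : EuclideanSpace ℝ (Fin N)) (max r 0 + 1))ᶜ),
      K x ≤ ε / M * V x ^ ((p - q) / (p - 2)) := by
    refine (ae_restrict_iff' measurableSet_ball.compl).2 (Eventually.of_forall fun x hx => ?_)
    rw [← div_le_iff₀ (Real.rpow_pos_of_pos (hV0 x) _)]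
    refine (hr ?_).le
    simp only [Set.mem_compl_iff, Metric.mem_ball, not_lt, Metric.mem_closedBall, not_le] at hx ⊢
    have := le_max_left r 0
    linarith
  refine (lintegral_weight_rpow_le hq (by positivity) hv.restrict hV.aemeasurable
    (fun x => (hV0 x).le) hK).trans ?_
  calc _ ≤ ENNReal.ofReal (ε / M) * (ENNReal.ofReal M ^ ((p - q) / (p - 2)) *
        ENNReal.ofReal M ^ ((q - 2) / (p - 2))) := by
        gcongr
        · exact (setLIntegral_le_lintegral _ _).trans hv1
        · exact (setLIntegral_le_lintegral _ _).trans hv2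
    _ = ENNReal.ofReal ε := by
        rw [← ENNReal.rpow_add_of_nonneg _ _ hθ hθ', hsum, ENNReal.rpow_one,
          ← ENNReal.ofReal_mul (by positivity), div_mul_cancel₀ _ hM.ne']

/-- Uniformity along sequences is uniformity over all sets: otherwise a bad set could be picked for
each radius `n + 1`, and these sets would form a sequence violating `VK2`. -/
theorem VK2.exists_forall_setLIntegral_le {N : ℕ} {V K : EuclideanSpace ℝ (Fin N) → ℝ}
    (h1 : VK1 V K) (h2 : VK2 K) {m ε : ℝ} (hm : 0 < m) (hε : 0 < ε) :
    ∃ r : ℝ, 0 < r ∧ ∀ A : Set (EuclideanSpace ℝ (Fin N)), MeasurableSet A →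
      volume A ≤ ENNReal.ofReal m →
      ∫⁻ x in A ∩ (Metric.ball 0 r)ᶜ, ENNReal.ofReal (K x) ≤ ENNReal.ofReal ε := by
  by_contra! hcon
  choose A hA hAm hAε using fun n : ℕ => hcon (n + 1) (by positivity)
  have hu := Metric.tendstoUniformly_iff.1 (h2 A hA m hm hAm) ε hε
  obtain ⟨n, hn⟩ := ((tendsto_natCast_atTop_atTop.comp (tendsto_add_atTop_nat 1)).eventually
    hu).exists
  have hn' := hn n
  refine absurd (hAε n) (not_lt.2 ?_)
  have hfin : IsFiniteMeasure (volume.restrict (A n ∩ (Metric.ball 0 ((n : ℝ) + 1))ᶜ)) := by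
    refine ⟨?_⟩
    rw [Measure.restrict_apply_univ]
    exact (measure_mono Set.inter_subset_left).trans_lt ((hAm n).trans_lt ENNReal.ofReal_lt_top)
  have hint : Integrable K (volume.restrict (A n ∩ (Metric.ball 0 ((n : ℝ) + 1))ᶜ)) :=
    (h1.2.restrict _).integrable le_top
  rw [← ofReal_integral_eq_lintegral_ofReal hint (Eventually.of_forall fun x => (h1.1 x).2.le)]
  refine ENNReal.ofReal_le_ofReal ?_
  simp only [Function.comp_apply, dist_zero_left, Real.norm_eq_abs, Nat.cast_add,
    Nat.cast_one] at hn'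
  exact (le_abs_self _).trans hn'.le

/-- Since `2 < q < p`, `K |v|^q` is at most `δ V |v|²` where `|v| < t₀` and at most `δ |v|^p` where
`|v| > t₁`. What remains is at most `t₁^q K` on a set where essentially `|v| ≥ t₀`; by Chebyshev's
inequality its measure is bounded in terms of `M` alone, so `VK2` applies with a radius independent
of `v`. -/
theorem VK3.uniformTail {N : ℕ} {V K : EuclideanSpace ℝ (Fin N) → ℝ} (hV : Continuous V)
    (h1 : VK1 V K) (h2 : VK2 K) (h3 : VK3 V K) {p q : ℝ} (hq : q ∈ Set.Ioo 2 p) :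
    UniformTail V K p q := by
  intro M ε hM hε
  obtain ⟨hq1, hq2⟩ := hq
  have hp0 : 0 < p := by linarith
  obtain ⟨k₀, hk₀, hK⟩ := h1.2.exists_ae_le
  obtain ⟨k₁, hk₁, hKV⟩ := MemLp.exists_ae_le h3
  -- The small and large values each contribute `δ M = ε/4`, the medium ones `ε/2`.
  set δ := ε / (4 * M) with hδ
  have hδ0 : 0 < δ := by positivity
  obtain ⟨t₀, ht₀, ht₀'⟩ : ∃ t : ℝ, 0 < t ∧ t ^ (q - 2) = δ / k₁ := by
    refine ⟨(δ / k₁) ^ (q - 2)⁻¹, by positivity, ?_⟩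
    rw [← Real.rpow_mul (by positivity), inv_mul_cancel₀ (by linarith), Real.rpow_one]
  obtain ⟨t₁, ht₁, ht₁'⟩ : ∃ t : ℝ, 0 < t ∧ t ^ (q - p) = δ / k₀ := by
    refine ⟨(δ / k₀) ^ (q - p)⁻¹, by positivity, ?_⟩
    rw [← Real.rpow_mul (by positivity), inv_mul_cancel₀ (by linarith), Real.rpow_one]
  obtain ⟨r, hr0, hr⟩ := h2.exists_forall_setLIntegral_le h1 (m := M / t₀ ^ p)
    (ε := ε / (2 * t₁ ^ q)) (by positivity) (by positivity)
  refine ⟨r, hr0, fun v hv hv1 hv2 => ?_⟩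
  -- `v` is only almost everywhere measurable, while `VK2` asks for Borel sets; the measurable hull
  -- has the same measure.
  set A := toMeasurable volume {x | ENNReal.ofReal (t₀ ^ p) ≤ ‖v x‖ₑ ^ p} with hA
  have hAm : volume A ≤ ENNReal.ofReal (M / t₀ ^ p) := by
    rw [hA, measure_toMeasurable]
    refine (meas_ge_le_lintegral_div (hv.enorm.pow_const p) ?_ ENNReal.ofReal_ne_top).trans ?_
    · rw [ne_eq, ENNReal.ofReal_eq_zero, not_le]
      positivity
    · rw [ENNReal.ofReal_div_of_pos (by positivity)]
      gcongr
  have hmeas : MeasurableSet A := measurableSet_toMeasurable _ _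
  have hpt : ∀ᵐ x, ENNReal.ofReal (K x * |v x| ^ q) ≤
      ENNReal.ofReal δ * ENNReal.ofReal (V x * |v x| ^ 2) + ENNReal.ofReal δ * ‖v x‖ₑ ^ p +
        ENNReal.ofReal (t₁ ^ q) * A.indicator (fun x => ENNReal.ofReal (K x)) x := by
    filter_upwards [hK, hKV] with x hx hx'
    have hVx := (h1.1 x).1
    have hKx := (h1.1 x).2
    rw [div_le_iff₀ hVx] at hx'
    have hvx := abs_nonneg (v x)
    by_cases hxA : x ∈ A
    · rcases le_or_gt (|v x|) t₁ with hle | hgt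
      · refine le_trans ?_ le_add_self
        rw [Set.indicator_of_mem hxA, ← ENNReal.ofReal_mul (by positivity)]
        refine ENNReal.ofReal_le_ofReal ?_
        rw [mul_comm]
        gcongr
      · refine le_trans ?_ (le_self_add.trans' le_add_self)
        rw [enorm_rpow_eq_ofReal _ hp0.le, ← ENNReal.ofReal_mul hδ0.le]
        refine ENNReal.ofReal_le_ofReal ?_
        have hpos : 0 < |v x| := ht₁.trans hgt
        have e : |v x| ^ q = |v x| ^ (q - p) * |v x| ^ p := by
          rw [← Real.rpow_add hpos]; congr 1; ring
        have h4 : |v x| ^ (q - p) ≤ δ / k₀ := by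
          rw [← ht₁']
          exact Real.rpow_le_rpow_of_nonpos ht₁ hgt.le (by linarith)
        calc K x * |v x| ^ q = K x * |v x| ^ (q - p) * |v x| ^ p := by rw [e]; ring
          _ ≤ k₀ * (δ / k₀) * |v x| ^ p := by gcongr
          _ = δ * |v x| ^ p := by field_simp
    · refine le_trans ?_ (le_self_add.trans' le_self_add)
      rw [← ENNReal.ofReal_mul hδ0.le]
      refine ENNReal.ofReal_le_ofReal ?_
      have hlt : |v x| < t₀ := by
        have h5 : ¬ ENNReal.ofReal (t₀ ^ p) ≤ ‖v x‖ₑ ^ p := fun h => hxA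
          (subset_toMeasurable _ _ h)
        rw [enorm_rpow_eq_ofReal _ hp0.le, ENNReal.ofReal_le_ofReal_iff (by positivity)] at h5
        by_contra! h6
        exact h5 (Real.rpow_le_rpow ht₀.le h6 hp0.le)
      have e : |v x| ^ q = |v x| ^ (q - 2) * |v x| ^ 2 := by
        rw [← Real.rpow_two, ← Real.rpow_add_of_nonneg hvx (by linarith) (by norm_num)]
        congr 1; ring
      have h4 : |v x| ^ (q - 2) ≤ δ / k₁ := by
        rw [← ht₀']
        exact Real.rpow_le_rpow hvx hlt.le (by linarith)
      calc K x * |v x| ^ q = K x * |v x| ^ (q - 2) * |v x| ^ 2 := by rw [e]; ring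
        _ ≤ k₁ * V x * (δ / k₁) * |v x| ^ 2 := by gcongr
        _ = δ * (V x * |v x| ^ 2) := by field_simp
  have hf1 : AEMeasurable (fun x => ENNReal.ofReal (V x * |v x| ^ 2)) volume := by
    simp only [sq_abs]
    exact (hV.aemeasurable.mul (hv.pow_const 2)).ennreal_ofReal
  have hf2 : AEMeasurable (fun x => ‖v x‖ₑ ^ p) volume := hv.enorm.pow_const p
  refine (lintegral_mono_ae (ae_restrict_of_ae hpt)).trans ?_
  have hf12 : AEMeasurable (fun x => ENNReal.ofReal δ * ENNReal.ofReal (V x * |v x| ^ 2) +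
      ENNReal.ofReal δ * ‖v x‖ₑ ^ p) volume := (hf1.const_mul _).add (hf2.const_mul _)
  rw [lintegral_add_left' hf12.restrict, lintegral_add_left' (hf1.const_mul _).restrict,
    lintegral_const_mul' _ _ ENNReal.ofReal_ne_top, lintegral_const_mul' _ _ ENNReal.ofReal_ne_top,
    lintegral_const_mul' _ _ ENNReal.ofReal_ne_top, lintegral_indicator hmeas,
    Measure.restrict_restrict hmeas]
  calc _ ≤ ENNReal.ofReal δ * ENNReal.ofReal M + ENNReal.ofReal δ * ENNReal.ofReal M +
        ENNReal.ofReal (t₁ ^ q) * ENNReal.ofReal (ε / (2 * t₁ ^ q)) := by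
        gcongr
        · exact (setLIntegral_le_lintegral _ _).trans hv1
        · exact (setLIntegral_le_lintegral _ _).trans hv2
        · exact hr A hmeas hAm
    _ = ENNReal.ofReal ε := by
        rw [← ENNReal.ofReal_mul (by positivity), ← ENNReal.ofReal_mul (by positivity),
          ← ENNReal.ofReal_add (by positivity) (by positivity),
          ← ENNReal.ofReal_add (by positivity) (by positivity)]
        congr 1
        rw [hδ]
        field_simp
        ring

/-! ### Bounds for differences and local compactness. -/

theorem enorm_add_rpow_le (a b : ℝ) {p : ℝ} (hp : 1 ≤ p) :
    ‖a + b‖ₑ ^ p ≤ 2 ^ (p - 1) * (‖a‖ₑ ^ p + ‖b‖ₑ ^ p) :=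
  (ENNReal.rpow_le_rpow (enorm_add_le a b) (by linarith)).trans
    (ENNReal.rpow_add_le_mul_rpow_add_rpow _ _ hp)

theorem lintegral_enorm_sub_rpow_le {X : Type*} [MeasurableSpace X] {μ : Measure X} {u v : X → ℝ}
    (hu : AEMeasurable u μ) {p : ℝ} (hp : 1 ≤ p) :
    ∫⁻ x, ‖u x - v x‖ₑ ^ p ∂μ ≤
      2 ^ (p - 1) * (∫⁻ x, ‖u x‖ₑ ^ p ∂μ + ∫⁻ x, ‖v x‖ₑ ^ p ∂μ) := by
  rw [← lintegral_add_left' (hu.enorm.pow_const p), ← lintegral_const_mul' _ _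
    (ENNReal.rpow_ne_top_of_nonneg (by linarith) (by norm_num))]
  refine lintegral_mono fun x => ?_
  have := enorm_add_rpow_le (u x) (-v x) hp
  rwa [enorm_neg, ← sub_eq_add_neg] at this

theorem potentialEnergy_sub_le {N : ℕ} {V u v : EuclideanSpace ℝ (Fin N) → ℝ}
    (hV : AEMeasurable V volume) (hV0 : ∀ x, 0 ≤ V x) (hu : AEMeasurable u volume) :
    potentialEnergy V (fun x => u x - v x) ≤ 2 * (potentialEnergy V u + potentialEnergy V v) := by
  have hf : AEMeasurable (fun x => ENNReal.ofReal (V x * |u x| ^ 2)) volume := by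
    simp only [sq_abs]
    exact (hV.mul (hu.pow_const 2)).ennreal_ofReal
  rw [potentialEnergy, potentialEnergy, potentialEnergy, ← lintegral_add_left' hf,
    ← lintegral_const_mul' _ _ (by norm_num)]
  refine lintegral_mono fun x => ?_
  have hVx := hV0 x
  rw [← ENNReal.ofReal_add (by positivity) (by positivity), ← ENNReal.ofReal_ofNat 2,
    ← ENNReal.ofReal_mul (by norm_num)]
  refine ENNReal.ofReal_le_ofReal ?_
  simp only [sq_abs]
  nlinarith [mul_nonneg hVx (sq_nonneg (u x + v x))]

theorem gagliardoSq_sub_le {N : ℕ} (α : ℝ) {u v : EuclideanSpace ℝ (Fin N) → ℝ}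
    (hu : AEMeasurable u volume) :
    gagliardoSq α (fun x => u x - v x) ≤ 2 * (gagliardoSq α u + gagliardoSq α v) := by
  rw [gagliardoSq, gagliardoSq, gagliardoSq,
    ← lintegral_add_left' (aemeasurable_gagliardo_integrand α hu),
    ← lintegral_const_mul' _ _ (by norm_num)]
  refine lintegral_mono fun x => ?_
  refine le_of_le_of_eq ?_ (congrArg (· * _) (ENNReal.ofReal_ofNat 2))
  rw [← ENNReal.ofReal_add (by positivity) (by positivity), ← ENNReal.ofReal_mul (by norm_num),
    ← add_div, mul_div_assoc']
  refine ENNReal.ofReal_le_ofReal ?_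
  gcongr
  simp only [sq_abs]
  nlinarith [sq_nonneg (u x.1 - u x.2 + (v x.1 - v x.2))]

/-- Each `x` lies in some covering ball, where `u x` is close to the mean. That mean is bounded by
the sum over all the balls, so no measurable choice of a ball is needed. -/
theorem setLIntegral_ball_sq_le_of_cover {N : ℕ} {α : ℝ} (hα : 0 ≤ α)
    {u : EuclideanSpace ℝ (Fin N) → ℝ} {p : ℝ≥0∞} (hp : 1 ≤ p) (hu : MemLp u p volume)
    {ι : Type*} {t : Finset ι} {c : ι → EuclideanSpace ℝ (Fin N)} {h R : ℝ}
    (ht : Metric.ball 0 R ⊆ ⋃ i ∈ t, Metric.ball (c i) h) :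
    ∫⁻ x in Metric.ball 0 R, ‖u x‖ₑ ^ (2 : ℝ) ≤
      2 * (ENNReal.ofReal (ballPoincareConst N α * h ^ (2 * α)) * gagliardoSq α u +
        volume (Metric.ball (0 : EuclideanSpace ℝ (Fin N)) R) *
          ∑ i ∈ t, ‖⨍ y in Metric.ball (c i) h, u y‖ₑ ^ (2 : ℝ)) := by
  have hpt : ∀ x ∈ Metric.ball (0 : EuclideanSpace ℝ (Fin N)) R, ‖u x‖ₑ ^ (2 : ℝ) ≤
      2 * (ENNReal.ofReal (ballPoincareConst N α * h ^ (2 * α)) * gagliardoDensity α u x +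
        ∑ i ∈ t, ‖⨍ y in Metric.ball (c i) h, u y‖ₑ ^ (2 : ℝ)) := by
    intro x hx
    obtain ⟨i, hi, hxi⟩ := Set.mem_iUnion₂.1 (ht hx)
    have h1 := enorm_sub_setAverage_ball_le hα hu.1 hxi (hu.integrableOn_ball hp _ _)
    have h2 := enorm_add_rpow_le (u x - ⨍ y in Metric.ball (c i) h, u y)
      (⨍ y in Metric.ball (c i) h, u y) (p := 2) (by norm_num)
    rw [sub_add_cancel] at h2
    have e : (2 : ℝ≥0∞) ^ ((2 : ℝ) - 1) = 2 := by norm_num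
    rw [e] at h2
    exact h2.trans (mul_le_mul_right (add_le_add h1 (Finset.single_le_sum
      (f := fun i => ‖⨍ y in Metric.ball (c i) h, u y‖ₑ ^ (2 : ℝ)) (fun _ _ => zero_le) hi)) _)
  refine (setLIntegral_mono' measurableSet_ball hpt).trans ?_
  rw [lintegral_const_mul' _ _ (by norm_num), lintegral_add_right _ measurable_const,
    lintegral_const_mul' _ _ ENNReal.ofReal_ne_top, lintegral_const, Measure.restrict_apply_univ,
    mul_comm (volume _), ← lintegral_gagliardoDensity α hu.1.aemeasurable]
  gcongr
  exact Measure.restrict_le_self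

/-- A sequence bounded in `Lᵖ` has a subsequence along which the averages over all balls of a
countable family converge. -/
theorem exists_subseq_setAverage_ball_tendsto {N : ℕ} {p : ℝ} (hp : 1 ≤ p) {M : ℝ}
    {u : ℕ → EuclideanSpace ℝ (Fin N) → ℝ} (hu : ∀ n, AEStronglyMeasurable (u n) volume)
    (hM : ∀ n, ∫⁻ x, ‖u n x‖ₑ ^ p ≤ ENNReal.ofReal M) {ι : Type*} [Countable ι]
    (c : ι → EuclideanSpace ℝ (Fin N)) {h : ι → ℝ} (hh : ∀ i, 0 < h i) :
    ∃ k : ℕ → ℕ, StrictMono k ∧ ∀ i, ∃ l : ℝ,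
      Tendsto (fun n => ⨍ y in Metric.ball (c i) (h i), u (k n) y) atTop (𝓝 l) := by
  have hp0 : 0 < p := by linarith
  obtain ⟨B, hB⟩ : ∃ B : ι → ℝ, ∀ i n, |⨍ y in Metric.ball (c i) (h i), u n y| ≤ B i := by
    refine ⟨fun i => (((h i ^ N *
      (volume (Metric.ball (0 : EuclideanSpace ℝ (Fin N)) 1)).toReal)⁻¹ * max M 0)) ^ (1 / p),
      fun i n => ?_⟩
    have hi := hh i
    have h1 := enorm_setAverage_ball_rpow_le hp (hu n) (c i) hi
    have h2 := h1.trans (mul_le_mul_right ((hM n).trans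
      (ENNReal.ofReal_le_ofReal (le_max_left M 0))) _)
    rw [← ENNReal.ofReal_mul (by positivity), enorm_rpow_eq_ofReal _ hp0.le,
      ENNReal.ofReal_le_ofReal_iff (by positivity)] at h2
    have h3 := Real.rpow_le_rpow (by positivity) h2 (by positivity : 0 ≤ 1 / p)
    rwa [← Real.rpow_mul (abs_nonneg _), mul_one_div_cancel hp0.ne', Real.rpow_one] at h3
  -- Diagonal extraction in the form of Tychonoff: a countable product of intervals is sequentially
  -- compact.
  have hcomp : IsCompact (Set.univ.pi fun i => Set.Icc (-B i) (B i)) :=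
    isCompact_univ_pi fun i => isCompact_Icc
  obtain ⟨l, -, k, hk, hlim⟩ := hcomp.tendsto_subseq
    (x := fun n i => ⨍ y in Metric.ball (c i) (h i), u n y)
    (fun n i _ => abs_le.1 (hB i n))
  exact ⟨k, hk, fun i => ⟨l i, (tendsto_pi_nhds.1 hlim) i⟩⟩

theorem setAverage_sub {X : Type*} [MeasurableSpace X] {μ : Measure X} {s : Set X} {f g : X → ℝ}
    (hf : IntegrableOn f s μ) (hg : IntegrableOn g s μ) :
    ⨍ x in s, (f x - g x) ∂μ = ⨍ x in s, f x ∂μ - ⨍ x in s, g x ∂μ := by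
  simp only [setAverage_eq, integral_sub hf hg, smul_sub]

/-- The local compactness underlying the embedding: a sequence with bounded Gagliardo seminorms
and convergent averages is Cauchy in `L²` of every ball. -/
theorem eventually_setLIntegral_ball_sub_sq_le {N : ℕ} {α : ℝ} (hα : 0 < α) {p : ℝ≥0∞}
    (hp : 1 ≤ p) {M : ℝ} (hM : 0 ≤ M)
    {v : ℕ → EuclideanSpace ℝ (Fin N) → ℝ} (hv : ∀ n, MemLp (v n) p volume)
    (hG : ∀ n m, gagliardoSq α (fun x => v n x - v m x) ≤ ENNReal.ofReal M)
    (hlim : ∀ i : ℕ × ℕ, ∃ l : ℝ, Tendsto (fun n => ⨍ y in Metric.ball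
      (TopologicalSpace.denseSeq (EuclideanSpace ℝ (Fin N)) i.1) (1 / ((i.2 : ℝ) + 1)), v n y)
      atTop (𝓝 l)) (R : ℝ) {η : ℝ} (hη : 0 < η) :
    ∀ᶠ n : ℕ × ℕ in atTop,
      ∫⁻ x in Metric.ball 0 R, ‖v n.1 x - v n.2 x‖ₑ ^ (2 : ℝ) ≤ ENNReal.ofReal η := by
  choose l hl using hlim
  have hA := ballPoincareConst_pos N α
  set A := ballPoincareConst N α
  set d := TopologicalSpace.denseSeq (EuclideanSpace ℝ (Fin N))
  -- The scale is fixed first, making the Poincaré term small for all pairs at once; only then are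
  -- finitely many means left to control.
  obtain ⟨j, hj⟩ : ∃ j : ℕ, A * (1 / ((j : ℝ) + 1)) ^ (2 * α) * M < η / 4 := by
    have h1 : Tendsto (fun j : ℕ => A * (1 / ((j : ℝ) + 1)) ^ (2 * α) * M) atTop
        (𝓝 (A * 0 ^ (2 * α) * M)) :=
      ((tendsto_one_div_add_atTop_nhds_zero_nat.rpow_const
        (Or.inr (by positivity))).const_mul A).mul_const M
    rw [Real.zero_rpow (by positivity), mul_zero, zero_mul] at h1
    exact (h1.eventually (gt_mem_nhds (by positivity))).exists
  set h : ℝ := 1 / ((j : ℝ) + 1) with hh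
  have hh0 : 0 < h := by positivity
  -- Centres from a dense sequence suffice, so the countable family of balls in `hlim` serves every
  -- `R` and every scale.
  obtain ⟨t, ht⟩ := (isCompact_closedBall (0 : EuclideanSpace ℝ (Fin N)) R).elim_finite_subcover
    (fun i => Metric.ball (d i) h) (fun i => Metric.isOpen_ball) (by
      intro x _
      obtain ⟨i, hi⟩ := (TopologicalSpace.denseRange_denseSeq
        (EuclideanSpace ℝ (Fin N))).exists_dist_lt x hh0
      exact Set.mem_iUnion.2 ⟨i, hi⟩)
  have ht' := Metric.ball_subset_closedBall.trans ht
  set a : ℕ → ℕ → ℝ := fun n i => ⨍ y in Metric.ball (d i) h, v n y with ha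
  have hvol : volume (Metric.ball (0 : EuclideanSpace ℝ (Fin N)) R) ≠ ⊤ := measure_ball_lt_top.ne
  set b := (volume (Metric.ball (0 : EuclideanSpace ℝ (Fin N)) R)).toReal with hb
  have hb0 : 0 ≤ b := ENNReal.toReal_nonneg
  have hsum : Tendsto (fun n : ℕ × ℕ => b * ∑ i ∈ t, |a n.1 i - a n.2 i| ^ (2 : ℝ)) atTop
      (𝓝 (b * ∑ i ∈ t, (0 : ℝ))) := by
    refine (tendsto_finsetSum t fun i _ => ?_).const_mul b
    rw [← prod_atTop_atTop_eq]
    have h1 := hl (i, j)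
    have h2 : Tendsto (fun n : ℕ × ℕ => |a n.1 i - a n.2 i| ^ (2 : ℝ)) (atTop ×ˢ atTop)
        (𝓝 (|l (i, j) - l (i, j)| ^ (2 : ℝ))) := ((h1.comp tendsto_fst).sub (h1.comp (tendsto_snd (f := atTop)))).abs.rpow_const
      (p := 2) (Or.inr (by norm_num))
    rwa [sub_self, abs_zero, Real.zero_rpow two_ne_zero] at h2
  simp only [Finset.sum_const_zero, mul_zero] at hsum
  filter_upwards [hsum.eventually (gt_mem_nhds (by positivity : 0 < η / 4))] with n hn
  refine (setLIntegral_ball_sq_le_of_cover hα.le hp ((hv n.1).sub (hv n.2)) ht').trans ?_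
  have e : ∀ i, ⨍ y in Metric.ball (d i) h, (v n.1 - v n.2) y = a n.1 i - a n.2 i := fun i =>
    setAverage_sub ((hv n.1).integrableOn_ball hp _ _) ((hv n.2).integrableOn_ball hp _ _)
  simp only [e]
  simp_rw [enorm_rpow_eq_ofReal _ zero_le_two]
  rw [← ENNReal.ofReal_sum_of_nonneg fun i _ => by positivity, ← ENNReal.ofReal_toReal hvol, ← hb,
    ← ENNReal.ofReal_mul hb0]
  calc _ ≤ 2 * (ENNReal.ofReal (A * h ^ (2 * α)) * ENNReal.ofReal M +
        ENNReal.ofReal (b * ∑ i ∈ t, |a n.1 i - a n.2 i| ^ (2 : ℝ))) := by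
        gcongr
        exact hG n.1 n.2
    _ = ENNReal.ofReal (2 * (A * h ^ (2 * α) * M +
          b * ∑ i ∈ t, |a n.1 i - a n.2 i| ^ (2 : ℝ))) := by
        rw [ENNReal.ofReal_mul zero_le_two, ENNReal.ofReal_add (by positivity) (by positivity),
          ENNReal.ofReal_mul (p := A * h ^ (2 * α)) (by positivity), ENNReal.ofReal_ofNat]
    _ ≤ _ := ENNReal.ofReal_le_ofReal (by linarith)

/-! ### Completeness of the weighted Lebesgue space. -/

/-- The measure `K dx`. -/
noncomputable def weightMeasure {N : ℕ} (K : EuclideanSpace ℝ (Fin N) → ℝ) :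
    Measure (EuclideanSpace ℝ (Fin N)) :=
  volume.withDensity fun x => ENNReal.ofReal (K x)

theorem normLK_eq_eLpNorm {N : ℕ} {K : EuclideanSpace ℝ (Fin N) → ℝ} (hK : Continuous K)
    (hK0 : ∀ x, 0 ≤ K x) {q : ℝ} (hq : 0 < q) {u : EuclideanSpace ℝ (Fin N) → ℝ}
    (hu : AEMeasurable u volume) :
    normLK K q u = eLpNorm u (ENNReal.ofReal q) (weightMeasure K) := by
  rw [eLpNorm_eq_lintegral_rpow_enorm_toReal (by simpa using hq) ENNReal.ofReal_ne_top,
    ENNReal.toReal_ofReal hq.le, weightMeasure, lintegral_withDensity_eq_lintegral_mul₀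
    hK.measurable.ennreal_ofReal.aemeasurable (hu.enorm.pow_const q), normLK]
  congr 2
  funext x
  rw [Pi.mul_apply, enorm_rpow_eq_ofReal _ hq.le, ENNReal.ofReal_mul (hK0 x)]

theorem normLK_lt_top_iff {N : ℕ} {K : EuclideanSpace ℝ (Fin N) → ℝ} {q : ℝ} (hq : 0 < q)
    {u : EuclideanSpace ℝ (Fin N) → ℝ} :
    normLK K q u < ⊤ ↔ ∫⁻ x, ENNReal.ofReal (K x * |u x| ^ q) < ⊤ :=
  ENNReal.rpow_lt_top_iff_of_pos (by positivity)

/-- The weighted Lebesgue space is complete. -/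
theorem exists_tendsto_normLK_of_cauchy {N : ℕ} {K : EuclideanSpace ℝ (Fin N) → ℝ}
    (hK : Continuous K) (hK0 : ∀ x, 0 ≤ K x) {q : ℝ} (hq : 1 ≤ q)
    {v : ℕ → EuclideanSpace ℝ (Fin N) → ℝ} (hv : ∀ n, v n ∈ spaceLK K q)
    (hcau : ∀ ε : ℝ, 0 < ε → ∀ᶠ n : ℕ × ℕ in atTop,
      ∫⁻ x, ENNReal.ofReal (K x * |v n.1 x - v n.2 x| ^ q) ≤ ENNReal.ofReal ε) :
    ∃ w ∈ spaceLK K q, Tendsto (fun n => normLK K q (fun x => v n x - w x)) atTop (𝓝 0) := by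
  have hq0 : 0 < q := by linarith
  have : Fact (1 ≤ ENNReal.ofReal q) := ⟨by simpa using hq⟩
  have hmem : ∀ n, MemLp (v n) (ENNReal.ofReal q) (weightMeasure K) := fun n =>
    ⟨((hv n).1.mono_ac (withDensity_absolutelyContinuous _ _)).aestronglyMeasurable, by
      rw [← normLK_eq_eLpNorm hK hK0 hq0 (hv n).1]
      exact (normLK_lt_top_iff hq0).2 (hv n).2⟩
  have hC : CauchySeq fun n => (hmem n).toLp (v n) := by
    rw [EMetric.cauchySeq_iff]
    intro ε hε
    obtain ⟨δ, hδ0, hδ⟩ : ∃ δ : ℝ, 0 < δ ∧ ENNReal.ofReal δ < ε := by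
      obtain ⟨δ, h1, h2⟩ := ENNReal.lt_iff_exists_nnreal_btwn.1 hε
      exact ⟨δ, by simpa using h1, by simpa using h2⟩
    -- The level is `δ^q` because `hcau` bounds the `q`-th power of the norm.
    obtain ⟨⟨n₁, n₂⟩, hn⟩ := eventually_atTop.1 (hcau (δ ^ q) (by positivity))
    refine ⟨max n₁ n₂, fun n hn1 m hm1 => ?_⟩
    have h1 := hn (n, m) ⟨(le_max_left _ _).trans hn1, (le_max_right _ _).trans hm1⟩
    rw [Lp.edist_toLp_toLp]
    change eLpNorm (fun x => v n x - v m x) _ _ < _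
    rw [← normLK_eq_eLpNorm (u := fun x => v n x - v m x) hK hK0 hq0 ((hv n).1.sub (hv m).1)]
    refine lt_of_le_of_lt (ENNReal.rpow_le_rpow h1 (by positivity)) ?_
    rwa [ENNReal.ofReal_rpow_of_nonneg (by positivity) (by positivity), ← Real.rpow_mul hδ0.le,
      mul_one_div_cancel hq0.ne', Real.rpow_one]
  obtain ⟨w, hw⟩ := cauchySeq_tendsto_of_complete hC
  have hwm : Measurable w := (Lp.stronglyMeasurable w).measurable
  refine ⟨w, ⟨hwm.aemeasurable, ?_⟩, ?_⟩
  · rw [← normLK_lt_top_iff hq0, normLK_eq_eLpNorm hK hK0 hq0 hwm.aemeasurable]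
    exact (Lp.memLp w).2
  · rw [tendsto_iff_edist_tendsto_0] at hw
    refine hw.congr fun n => ?_
    rw [normLK_eq_eLpNorm (u := fun x => v n x - w x) hK hK0 hq0
      ((hv n).1.sub hwm.aemeasurable), Lp.edist_def]
    refine eLpNorm_congr_ae ?_
    filter_upwards [(hmem n).coeFn_toLp] with x hx
    simp [hx]

/-! ### The compact embedding. -/

theorem eventually_lintegral_weight_sub_le {N : ℕ} {V K : EuclideanSpace ℝ (Fin N) → ℝ}
    (h1 : VK1 V K) {p q : ℝ} (hq : q ∈ Set.Ioo 2 p) (htail : UniformTail V K p q) {M : ℝ}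
    (hM : 0 < M) {v : ℕ → EuclideanSpace ℝ (Fin N) → ℝ} (hv : ∀ n, AEMeasurable (v n) volume)
    (hV : ∀ n m, potentialEnergy V (fun x => v n x - v m x) ≤ ENNReal.ofReal M)
    (hp : ∀ n m, ∫⁻ x, ‖v n x - v m x‖ₑ ^ p ≤ ENNReal.ofReal M)
    (hloc : ∀ R η : ℝ, 0 < η → ∀ᶠ n : ℕ × ℕ in atTop,
      ∫⁻ x in Metric.ball 0 R, ‖v n.1 x - v n.2 x‖ₑ ^ (2 : ℝ) ≤ ENNReal.ofReal η)
    {ε : ℝ} (hε : 0 < ε) :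
    ∀ᶠ n : ℕ × ℕ in atTop,
      ∫⁻ x, ENNReal.ofReal (K x * |v n.1 x - v n.2 x| ^ q) ≤ ENNReal.ofReal ε := by
  obtain ⟨k₀, hk₀, hK⟩ := h1.2.exists_ae_le
  obtain ⟨R, hR, htail⟩ := htail M (ε / 2) hM (by positivity)
  have hd : 0 < p - 2 := by linarith [hq.1, hq.2]
  have hθ : 0 < (p - q) / (p - 2) := div_pos (by linarith [hq.2]) hd
  have hθ' : 0 < (q - 2) / (p - 2) := div_pos (by linarith [hq.1]) hd
  -- Chosen so that interpolation on the ball, with weight 1 and `K ≤ k₀`, gives exactly `ε/2`. The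
  -- exponent of the `L²` factor is positive because `q < p`.
  obtain ⟨η, hη, hη'⟩ : ∃ η : ℝ, 0 < η ∧
      η ^ ((p - q) / (p - 2)) = ε / 2 / (k₀ * M ^ ((q - 2) / (p - 2))) := by
    refine ⟨(ε / 2 / (k₀ * M ^ ((q - 2) / (p - 2)))) ^ ((p - q) / (p - 2))⁻¹, by positivity, ?_⟩
    rw [← Real.rpow_mul (by positivity), inv_mul_cancel₀ hθ.ne', Real.rpow_one]
  filter_upwards [hloc R η hη] with n hn
  have hvn : AEMeasurable (fun x => v n.1 x - v n.2 x) volume := (hv n.1).sub (hv n.2)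
  have hin : ∫⁻ x in Metric.ball 0 R, ENNReal.ofReal (K x * |v n.1 x - v n.2 x| ^ q) ≤
      ENNReal.ofReal (ε / 2) := by
    refine (lintegral_weight_rpow_le (W := fun _ => 1) hq hk₀.le hvn.restrict aemeasurable_const
      (fun _ => zero_le_one) (ae_restrict_of_ae (hK.mono fun x hx => by simpa using hx))).trans ?_
    simp only [one_mul]
    have e : ∀ x, ENNReal.ofReal (|v n.1 x - v n.2 x| ^ 2) = ‖v n.1 x - v n.2 x‖ₑ ^ (2 : ℝ) :=
      fun x => by rw [enorm_rpow_eq_ofReal _ zero_le_two, Real.rpow_two]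
    simp only [e]
    calc _ ≤ ENNReal.ofReal k₀ * (ENNReal.ofReal η ^ ((p - q) / (p - 2)) *
          ENNReal.ofReal M ^ ((q - 2) / (p - 2))) := by
          gcongr
          exact (setLIntegral_le_lintegral _ _).trans (hp n.1 n.2)
      _ = ENNReal.ofReal (ε / 2) := by
          rw [ENNReal.ofReal_rpow_of_nonneg hη.le hθ.le, ENNReal.ofReal_rpow_of_nonneg hM.le hθ'.le,
            ← ENNReal.ofReal_mul (by positivity), ← ENNReal.ofReal_mul hk₀.le, hη']
          congr 1
          field_simp
  rw [← lintegral_add_compl _ (measurableSet_ball (x := 0) (ε := R))]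
  refine (add_le_add hin (htail _ hvn (hV _ _) (hp _ _))).trans ?_
  rw [← ENNReal.ofReal_add (by positivity) (by positivity), add_halves]

theorem compactlyEmbedded_spaceX {N : ℕ} {α : ℝ} (hα : 0 < α) (hN : 2 * α < (N : ℝ))
    {V K : EuclideanSpace ℝ (Fin N) → ℝ} (hV : Continuous V) (hK : Continuous K) (h1 : VK1 V K)
    {q c : ℝ} (hq : q ∈ Set.Ioo 2 (fracCritExp N α)) (hc : 0 < c)
    (hKV : ∀ᵐ x, K x ≤ c * V x ^ ((fracCritExp N α - q) / (fracCritExp N α - 2)))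
    (htail : UniformTail V K (fracCritExp N α) q) :
    CompactlyEmbedded (spaceX N α V) (normX α V) (spaceLK K q) (normLK K q) := by
  have hV0 : ∀ x, 0 ≤ V x := fun x => (h1.1 x).1.le
  obtain ⟨hsub, hcont⟩ := spaceX_continuously_embedded hα hN hV hV0 hq hc hKV
  refine ⟨hsub, hcont, ?_⟩
  rintro u hu ⟨M, hM⟩
  obtain ⟨C, hC, hsob⟩ := exists_fractional_sobolev_const hα hN
  have hp2 := two_lt_fracCritExp hα hN
  set p := fracCritExp N α
  have hp1 : 1 ≤ p := by linarith
  have hmem : ∀ n, MemLp (u n) (ENNReal.ofReal p) volume := fun n => memLp_of_mem_spaceX (hu n)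
  have hMr : ∀ n, normX α V (u n) ^ (2 : ℝ) ≤ ENNReal.ofReal ((M : ℝ) ^ (2 : ℝ)) := fun n => by
    rw [← ENNReal.ofReal_rpow_of_nonneg M.coe_nonneg zero_le_two, ENNReal.ofReal_coe_nnreal]
    exact ENNReal.rpow_le_rpow (hM n) zero_le_two
  have hG : ∀ n, gagliardoSq α (u n) ≤ ENNReal.ofReal ((M : ℝ) ^ (2 : ℝ)) := fun n =>
    (gagliardoSq_le_normX_sq α V (u n)).trans (hMr n)
  have hE : ∀ n, potentialEnergy V (u n) ≤ ENNReal.ofReal ((M : ℝ) ^ (2 : ℝ)) := fun n =>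
    (potentialEnergy_le_normX_sq α V (u n)).trans (hMr n)
  have hL : ∀ n, ∫⁻ x, ‖u n x‖ₑ ^ p ≤ ENNReal.ofReal (C * ((M : ℝ) ^ (2 : ℝ)) ^ (p / 2)) :=
    fun n => by
      rw [ENNReal.ofReal_mul hC.le, ← ENNReal.ofReal_rpow_of_nonneg (by positivity)
        (by positivity)]
      refine (hsob _ (hmem n)).trans ?_
      gcongr
      exact hG n
  obtain ⟨k, hk, hlim⟩ := exists_subseq_setAverage_ball_tendsto hp1 (fun n => (hmem n).1) hL
    (fun i : ℕ × ℕ => TopologicalSpace.denseSeq (EuclideanSpace ℝ (Fin N)) i.1)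
    (h := fun i => 1 / ((i.2 : ℝ) + 1)) (fun i => by positivity)
  -- One bound for the seminorm, the potential energy and the `L^p` integral of all differences; the
  -- `+ 1` keeps it positive when `M = 0`.
  set D : ℝ := max (4 * (M : ℝ) ^ (2 : ℝ))
    (2 ^ (p - 1) * (2 * (C * ((M : ℝ) ^ (2 : ℝ)) ^ (p / 2)))) + 1 with hD
  have hD1 : 4 * (M : ℝ) ^ (2 : ℝ) ≤ D := (le_max_left _ _).trans (le_add_of_nonneg_right zero_le_one)
  have hD2 : 2 ^ (p - 1) * (2 * (C * ((M : ℝ) ^ (2 : ℝ)) ^ (p / 2))) ≤ D :=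
    (le_max_right _ _).trans (le_add_of_nonneg_right zero_le_one)
  have hD0 : 0 < D := by positivity
  have hdouble : ∀ {a b : ℝ≥0∞}, a ≤ ENNReal.ofReal ((M : ℝ) ^ (2 : ℝ)) →
      b ≤ ENNReal.ofReal ((M : ℝ) ^ (2 : ℝ)) → 2 * (a + b) ≤ ENNReal.ofReal D := by
    intro a b ha hb
    calc 2 * (a + b) ≤ ENNReal.ofReal 2 * (ENNReal.ofReal ((M : ℝ) ^ (2 : ℝ)) +
          ENNReal.ofReal ((M : ℝ) ^ (2 : ℝ))) := by
          rw [ENNReal.ofReal_ofNat]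
          gcongr
      _ = ENNReal.ofReal (4 * (M : ℝ) ^ (2 : ℝ)) := by
          rw [← ENNReal.ofReal_add (by positivity) (by positivity),
            ← ENNReal.ofReal_mul zero_le_two]
          congr 1; ring
      _ ≤ _ := ENNReal.ofReal_le_ofReal hD1
  have hum : ∀ n, AEMeasurable (u n) volume := fun n => (hmem n).1.aemeasurable
  have hG' : ∀ n m, gagliardoSq α (fun x => u (k n) x - u (k m) x) ≤ ENNReal.ofReal D :=
    fun n m => (gagliardoSq_sub_le α (hum _)).trans (hdouble (hG _) (hG _))
  have hE' : ∀ n m, potentialEnergy V (fun x => u (k n) x - u (k m) x) ≤ ENNReal.ofReal D :=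
    fun n m => (potentialEnergy_sub_le hV.aemeasurable hV0 (hum _)).trans (hdouble (hE _) (hE _))
  have hL' : ∀ n m, ∫⁻ x, ‖u (k n) x - u (k m) x‖ₑ ^ p ≤ ENNReal.ofReal D := fun n m => by
    refine (lintegral_enorm_sub_rpow_le (hum _) hp1).trans ?_
    refine (mul_le_mul_right (add_le_add (hL _) (hL _)) _).trans ?_
    rw [← ENNReal.ofReal_add (by positivity) (by positivity), ← ENNReal.ofReal_ofNat 2,
      ENNReal.ofReal_rpow_of_pos (by norm_num), ← ENNReal.ofReal_mul (by positivity), ← two_mul]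
    exact ENNReal.ofReal_le_ofReal hD2
  obtain ⟨w, hw, hwlim⟩ := exists_tendsto_normLK_of_cauchy hK (fun x => (h1.1 x).2.le)
    (by linarith [hq.1]) (v := fun n => u (k n)) (fun n => hsub (hu _))
    (fun ε hε => eventually_lintegral_weight_sub_le h1 hq htail hD0 (fun n => hum (k n)) hE' hL'
      (fun R η hη => eventually_setLIntegral_ball_sub_sq_le hα (ofReal_one_le hp2) hD0.le
        (fun n => hmem (k n)) hG' hlim R hη) hε)
  exact ⟨w, hw, k, hk, hwlim⟩

theorem proposition2p2 (N : ℕ) (α : ℝ) (hα : α ∈ Set.Ioo (0 : ℝ) 1) (hN : 2 * α < (N : ℝ))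
    (V K : EuclideanSpace ℝ (Fin N) → ℝ) (hVK : ClassK α V K) :
    (VK3 V K → ∀ q ∈ Set.Ioo 2 (fracCritExp N α),
      CompactlyEmbedded (spaceX N α V) (normX α V) (spaceLK K q) (normLK K q)) ∧
    (∀ m : ℝ, VK4With α V K m →
      CompactlyEmbedded (spaceX N α V) (normX α V) (spaceLK K m) (normLK K m)) := by
  obtain ⟨hV, hK, h1, h2, -⟩ := hVK
  refine ⟨fun h3 q hq => ?_, fun m ⟨hm, hlim⟩ => ?_⟩
  · have hd : 0 < fracCritExp N α - 2 := by linarith [hq.1, hq.2]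
    obtain ⟨c, hc, hKV⟩ := h3.exists_ae_le_rpow h1
      (θ := (fracCritExp N α - q) / (fracCritExp N α - 2))
      (div_nonneg (by linarith [hq.2]) hd.le) ((div_le_one hd).2 (by linarith [hq.1]))
    exact compactlyEmbedded_spaceX hα.1 hN hV hK h1 hq hc hKV (h3.uniformTail hV h1 h2 hq)
  · obtain ⟨c, hc, hKV⟩ := exists_forall_le_rpow_of_tendsto hV hK (fun x => (h1.1 x).1) hlim
    exact compactlyEmbedded_spaceX hα.1 hN hV hK h1 hm hc (Eventually.of_forall hKV)
      (uniformTail_of_tendsto hV (fun x => (h1.1 x).1) hm hlim)
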